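/- Assume the Continuum Hypothesis, $\aleph_1 = 2^{\aleph_0}$. Let $X$ be a Tychonoff (completely regular $T_0$, equivalently completely regular Hausdorff) space in which every one-point set $\{x\}$ is a $G_\delta$, that is, an intersection of countably many open sets. Let $\mathcal{O}$ be the family of all open coverings of $X$. The long Menger game $\mathsf{G}_{\mathrm{fin}}^{\omega_1}(\mathcal{O},\mathcal{O})$ is played in innings $\xi<\omega_1$: in inning $\xi$ player I chooses an open covering $\mathcal{C}_\xi\in\mathcal{O}$, and then player II chooses a finite subset $\mathcal{F}_\xi\subseteq\mathcal{C}_\xi$. Player II wins if $\bigcup_{\xi<\omega_1}\mathcal{F}_\xi$ is a covering of $X$. A strategy for player II is a function assigning to every sequence $(\mathcal{C}_\eta)_{\eta\le\xi}$ of open coverings with $\xi<\omega_1$ a finite subset of $\mathcal{C}_\xi$; it is winning if player II wins every play in which the sets $\mathcal F_\xi$ are chosen according to it. If player II has a winning strategy in the game $\mathsf{G}_{\mathrm{fin}}^{\omega_1}(\mathcal{O},\mathcal{O})$ on $X$, then $|X|\le 2^{\aleph_0}$. -/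

import Mathlib

open scoped Cardinal Ordinal

/-- The family `O` of all open coverings of `X`. -/
def openCovers (X : Type*) [TopologicalSpace X] : Set (Set (Set X)) :=
  {𝒰 | (∀ U ∈ 𝒰, IsOpen U) ∧ ⋃₀ 𝒰 = Set.univ}

/-- A strategy for player II in the selection game `G_fin^κ(𝒜, ·)` of length `κ`: in each inning
`α < κ` player I chooses `A_α ∈ 𝒜`, and player II, knowing `(A_β)_{β ≤ α}`, answers with a finite
subset of `A_α`. -/
structure GfinStrategy {S : Type*} (κ : Ordinal) (𝒜 : Set (Set S)) where
  /-- The answer of player II in inning `α` to the moves of player I up to and including `α`. -/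
  move : (α : Set.Iio κ) → (Set.Iic α → 𝒜) → Set S
  move_finite : ∀ α φ, (move α φ).Finite
  move_subset : ∀ α φ, move α φ ⊆ (φ ⟨α, Set.mem_Iic.2 le_rfl⟩ : Set S)

/-- The strategy wins `G_fin^κ(𝒜, ℬ)`: against every sequence of moves of player I, the union of
the finite sets chosen by player II belongs to `ℬ`. -/
def GfinStrategy.IsWinning {S : Type*} {κ : Ordinal} {𝒜 : Set (Set S)}
    (F : GfinStrategy κ 𝒜) (ℬ : Set (Set S)) : Prop :=
  ∀ φ : Set.Iio κ → 𝒜, (⋃ α : Set.Iio κ, F.move α (fun β => φ β)) ∈ ℬ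

/-- Player II has a winning strategy in `G_fin^κ(𝒜, ℬ)`. -/
def PlayerIIWinsGfin {S : Type*} (κ : Ordinal) (𝒜 ℬ : Set (Set S)) : Prop :=
  ∃ F : GfinStrategy κ 𝒜, F.IsWinning ℬ

open Set Filter Topology

/-! ### Sets of cardinality at most the continuum -/

/-! Fix a winning strategy for II. For a position `p`, let `K p` be the set of points lying in the
closure of the union of II's answer to every next cover. Regularity makes `K p` compact, so, points
being `Gδ`, it has at most `𝔠` points and is an intersection of at most `𝔠` open sets. Constant
plays of I show that every open cover has a subcover of size at most `𝔠`; hence `𝔠` covers already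
cut out `K p` (`exists_continuum_covers`). Restrict I to these covers. The resulting tree has height
`ω₁`, hence at most `ℵ₁ * 𝔠 ^ ℵ₀ = 𝔠` positions. The sets `K p` over this tree cover `X`: a point
`y` outside all of them lets I always play a cover whose answer misses `y`, and II loses. -/

theorem mk_iUnion_le_continuum {α : Type*} {ι : Type*} {f : ι → Set α}
    (hι : Cardinal.mk ι ≤ 𝔠) (hf : ∀ i, Cardinal.mk (f i) ≤ 𝔠) :
    Cardinal.mk (⋃ i, f i) ≤ 𝔠 := by
  rw [← Cardinal.lift_le_continuum]
  refine (Cardinal.mk_iUnion_le_lift f).trans ?_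
  rw [← Cardinal.continuum_mul_self]
  refine mul_le_mul' (Cardinal.lift_le_continuum.2 hι)
    (ciSup_le' fun i => Cardinal.lift_le_continuum.2 (hf i))

/-- Lets `Set ℕ` serve as one type of codes for the moves of I at every position. -/
theorem exists_range_eq_of_mk_le_continuum {α : Type*} {s : Set α} (hs : s.Nonempty)
    (hc : Cardinal.mk s ≤ 𝔠) : ∃ e : Set ℕ → α, range e = s := by
  have h : Cardinal.lift.{0} (Cardinal.mk s) ≤ Cardinal.lift (Cardinal.mk (Set ℕ)) := by
    simpa using hc
  obtain ⟨g⟩ := Cardinal.lift_mk_le'.1 h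
  have : Nonempty s := hs.to_subtype
  refine ⟨fun j => (Function.invFun g j : s), ?_⟩
  ext x
  constructor
  · rintro ⟨j, rfl⟩
    exact Subtype.coe_prop _
  · intro hx
    exact ⟨g ⟨x, hx⟩, by simp [Function.leftInverse_invFun g.injective _]⟩

/-- Every point lies in a set of size at most the continuum that is closed under a given family
of at most continuum many operations of countable arity. -/
theorem exists_closed_under_operations {Y : Type*} {A : Type} (hA : Cardinal.mk A ≤ 𝔠)
    (op : A → (ℕ → Y) → Y) (y₀ : Y) :
    ∃ H : Set Y, y₀ ∈ H ∧ Cardinal.mk H ≤ 𝔠 ∧ ∀ a x, (∀ n, x n ∈ H) → op a x ∈ H := by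
  -- Terms over one constant `none` for `y₀` and a symbol of arity `ℕ` for each `a`; `H` will be the
  -- set of their values. Since `𝔠 ^ ℵ₀ = 𝔠`, there are at most `𝔠` terms.
  let β : Option A → Type := fun a => a.elim Empty (fun _ => ℕ)
  let ev : (Σ a, β a → Y) → Y := fun p =>
    match p with
    | ⟨none, _⟩ => y₀
    | ⟨some a, x⟩ => op a x
  have hW : Cardinal.mk (WType β) ≤ 𝔠 := by
    refine WType.cardinalMk_le_of_le ?_
    have hterm : ∀ a : Option A, (𝔠 : Cardinal.{0}) ^ Cardinal.mk (β a) ≤ 𝔠 := by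
      rintro (_ | a)
      · simpa [β] using Cardinal.nat_lt_continuum 1 |>.le
      · simp [β]
    refine (Cardinal.sum_le_sum _ (fun _ => 𝔠) hterm).trans ?_
    have : Cardinal.mk (Option A) ≤ 𝔠 := by
      rw [Cardinal.mk_option]
      exact Cardinal.add_le_of_le Cardinal.aleph0_le_continuum hA
        (Cardinal.nat_lt_continuum 1 |>.le.trans' (by simp))
    rw [Cardinal.sum_const']
    exact (mul_le_mul_left this _).trans Cardinal.continuum_mul_self.le
  refine ⟨range (WType.elim Y ev), ⟨WType.mk none Empty.elim, rfl⟩, ?_, ?_⟩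
  · rw [← Cardinal.lift_le_continuum]
    exact Cardinal.mk_range_le_lift.trans (Cardinal.lift_le_continuum.2 hW)
  · intro a x hx
    choose w hw using hx
    refine ⟨WType.mk (some a) w, ?_⟩
    change op a (fun n => WType.elim Y ev (w n)) = _
    simp only [hw]

/-! ### Compact spaces with `Gδ` points -/

theorem exists_isOpen_iInter_eq_singleton {X : Type*} [TopologicalSpace X] {x : X}
    (h : IsGδ ({x} : Set X)) :
    ∃ U : ℕ → Set X, (∀ n, IsOpen (U n)) ∧ ⋂ n, U n = {x} := by
  obtain ⟨U, hU, hx⟩ := h.eq_iInter_nat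
  exact ⟨U, hU, hx.symm⟩

/-- A set closed under limits of sequences along a fixed nonprincipal ultrafilter is closed in a
compact Hausdorff space with `Gδ` points. -/
theorem isClosed_of_hyperfilter_lim_mem {Y : Type*} [TopologicalSpace Y] [CompactSpace Y]
    [T2Space Y] (hGδ : ∀ y : Y, IsGδ ({y} : Set Y)) {H : Set Y}
    (hH : ∀ x : ℕ → Y, (∀ n, x n ∈ H) → ((hyperfilter ℕ).map x).lim ∈ H) : IsClosed H := by
  refine isClosed_of_closure_subset fun y hy => ?_
  obtain ⟨U, hUo, hU⟩ := exists_isOpen_iInter_eq_singleton (hGδ y)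
  have hyU : ∀ n, y ∈ U n := fun n => mem_iInter.1 (hU.symm ▸ mem_singleton y) n
  have hV : ∀ n, ∃ V, IsOpen V ∧ y ∈ V ∧ closure V ⊆ U n := fun n => by
    obtain ⟨V, hV, hVc, hVU⟩ := exists_mem_nhds_isClosed_subset ((hUo n).mem_nhds (hyU n))
    exact ⟨interior V, isOpen_interior, mem_interior_iff_mem_nhds.2 hV,
      (closure_minimal interior_subset hVc).trans hVU⟩
  choose V hVo hyV hVU using hV
  -- Diagonal choice: the sequence is eventually in each `V i`, so its limit is in every `closure (V
  -- i) ⊆ U i`.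
  have hx : ∀ n, ∃ x, x ∈ (⋂ i ∈ Finset.range (n + 1), V i) ∩ H := fun n =>
    mem_closure_iff.1 hy _ (isOpen_biInter_finset fun i _ => hVo i)
      (mem_iInter₂.2 fun i _ => hyV i)
  choose x hx using hx
  have hlim : ((hyperfilter ℕ).map x).lim ∈ H := hH x fun n => (hx n).2
  suffices ((hyperfilter ℕ).map x).lim = y by rwa [this] at hlim
  have hle : (((hyperfilter ℕ).map x : Ultrafilter Y) : Filter Y) ≤
      𝓝 ((hyperfilter ℕ).map x).lim := Ultrafilter.le_nhds_lim _
  rw [← mem_singleton_iff, ← hU]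
  refine mem_iInter.2 fun i => hVU i ?_
  have hev : ∀ᶠ n in (hyperfilter ℕ : Filter ℕ), x n ∈ V i := by
    refine Nat.hyperfilter_le_atTop (eventually_atTop.2 ⟨i, fun n hn => ?_⟩)
    exact mem_iInter₂.1 (hx n).1 i (Finset.mem_range.2 (Nat.lt_succ_of_le hn))
  exact mem_closure_of_tendsto (f := x) (b := (hyperfilter ℕ : Filter ℕ)) hle hev

/-- A closing-off argument: `H` is closed under ultrafilter limits, hence compact. If `y ∉ H`,
finitely many `U x (n x)` omitting `y` cover `H`, yet closure under the second kind of operation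
puts a point outside them into `H`. -/
theorem mk_le_continuum_of_compactSpace {Y : Type*} [TopologicalSpace Y] [CompactSpace Y]
    [T2Space Y] (hGδ : ∀ y : Y, IsGδ ({y} : Set Y)) : Cardinal.mk Y ≤ 𝔠 := by
  classical
  rcases isEmpty_or_nonempty Y with hY | ⟨⟨y₀⟩⟩
  · simp
  choose U hUo hU using fun y => exists_isOpen_iInter_eq_singleton (hGδ y)
  let op : Option (ℕ → ℕ) → (ℕ → Y) → Y := fun a x =>
    match a with
    | none => ((hyperfilter ℕ).map x).lim
    | some f => if h : ∃ y, y ∉ ⋃ i, U (x i) (f i) then h.choose else y₀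
  have hA : Cardinal.mk (Option (ℕ → ℕ)) ≤ 𝔠 := by
    simpa using (Cardinal.continuum_add_nat 1).le
  obtain ⟨H, hy₀, hHc, hH⟩ := exists_closed_under_operations hA op y₀
  have hcl : IsClosed H := isClosed_of_hyperfilter_lim_mem hGδ fun x hx => hH none x hx
  suffices H = univ by rwa [this, Cardinal.mk_univ] at hHc
  by_contra hne
  obtain ⟨y, hy⟩ := (ne_univ_iff_exists_notMem H).1 hne
  have hn : ∀ x : Y, ∃ n, x ∈ H → y ∉ U x n := fun x => by
    by_cases hx : x ∈ H
    · have : y ∉ ⋂ n, U x n := by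
        rw [hU]
        rintro rfl
        exact hy hx
      obtain ⟨n, hn⟩ := not_forall.1 (mt mem_iInter.2 this)
      exact ⟨n, fun _ => hn⟩
    · exact ⟨0, fun h => absurd h hx⟩
  choose n hn using hn
  have hmem : ∀ x m, x ∈ U x m := fun x m => mem_iInter.1 ((hU x).symm ▸ mem_singleton x) m
  obtain ⟨t, htH, htc⟩ := hcl.isCompact.elim_nhds_subcover (fun x => U x (n x))
    fun x _ => (hUo x _).mem_nhds (hmem x _)
  have htne : (t : Set Y).Nonempty := by
    obtain ⟨x, hx, -⟩ := mem_iUnion₂.1 (htc hy₀)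
    exact ⟨x, hx⟩
  -- Operations take sequences, so the finite subcover is listed with repetitions.
  obtain ⟨x, hx⟩ := t.countable_toSet.exists_eq_range htne
  have hxt : ∀ i, x i ∈ t := fun i => by
    have : x i ∈ (t : Set Y) := hx ▸ mem_range_self i
    exact this
  have hex : ∃ z, z ∉ ⋃ i, U (x i) (n (x i)) :=
    ⟨y, fun h => by
      obtain ⟨i, hi⟩ := mem_iUnion.1 h
      exact hn _ (htH _ (hxt i)) hi⟩
  have hop : op (some fun i => n (x i)) x ∈ H := hH (some fun i => n (x i)) x fun i => htH _ (hxt i)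
  have hop' : op (some fun i => n (x i)) x ∉ ⋃ i, U (x i) (n (x i)) := by
    simp only [op, dif_pos hex]
    exact hex.choose_spec
  obtain ⟨z, hz, hzU⟩ := mem_iUnion₂.1 (htc hop)
  obtain ⟨i, rfl⟩ : z ∈ range x := hx ▸ hz
  exact hop' (mem_iUnion.2 ⟨i, hzU⟩)

theorem IsCompact.mk_le_continuum {X : Type*} [TopologicalSpace X] [T2Space X]
    (hGδ : ∀ x : X, IsGδ ({x} : Set X)) {K : Set X} (hK : IsCompact K) :
    Cardinal.mk K ≤ 𝔠 := by
  have := isCompact_iff_compactSpace.1 hK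
  refine mk_le_continuum_of_compactSpace fun y => ?_
  have h := (hGδ (y : X)).preimage (f := ((↑) : K → X)) continuous_subtype_val
  rwa [← image_singleton, preimage_image_eq _ Subtype.val_injective] at h

/-- A compact set with `Gδ` points is the intersection of at most continuum many open sets. -/
theorem IsCompact.exists_iInter_isOpen_eq {X : Type*} [TopologicalSpace X] [T2Space X]
    (hGδ : ∀ x : X, IsGδ ({x} : Set X)) {K : Set X} (hK : IsCompact K) :
    ∃ 𝒲 : Set (Set X), Cardinal.mk 𝒲 ≤ 𝔠 ∧ (∀ W ∈ 𝒲, IsOpen W ∧ K ⊆ W) ∧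
      ∀ y ∉ K, ∃ W ∈ 𝒲, y ∉ W := by
  classical
  choose U hUo hU using fun x => exists_isOpen_iInter_eq_singleton (hGδ x)
  -- Finite unions of basic sets centred in `K`; by compactness those containing `K` separate it
  -- from each outside point.
  let w : Finset (K × ℕ) → Set X := fun t => ⋃ p ∈ t, U p.1 p.2
  refine ⟨range w ∩ {W | K ⊆ W}, ?_, ?_, ?_⟩
  · refine (Cardinal.mk_le_mk_of_subset inter_subset_left).trans (Cardinal.mk_range_le.trans ?_)
    have hprod : Cardinal.mk (K × ℕ) ≤ 𝔠 := by
      simpa using mul_le_mul' (hK.mk_le_continuum hGδ) Cardinal.aleph0_le_continuum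
    rcases finite_or_infinite (K × ℕ) with h | h
    · exact (Cardinal.mk_le_aleph0).trans Cardinal.aleph0_le_continuum
    · rwa [Cardinal.mk_finset_of_infinite]
  · rintro _ ⟨⟨t, rfl⟩, hKt⟩
    exact ⟨isOpen_biUnion fun p _ => hUo _ _, hKt⟩
  · intro y hy
    have hn : ∀ x : K, ∃ n, y ∉ U x n := fun x => by
      have : y ∉ ⋂ n, U x n := by
        rw [hU]
        rintro rfl
        exact hy x.2
      exact not_forall.1 (mt mem_iInter.2 this)
    choose n hn using hn
    have hmem : ∀ x m, x ∈ U x m := fun x m => mem_iInter.1 ((hU x).symm ▸ mem_singleton x) m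
    obtain ⟨t, ht⟩ := hK.elim_finite_subcover (fun x : K => U x (n x)) (fun x => hUo _ _)
      fun x hx => mem_iUnion.2 ⟨⟨x, hx⟩, hmem _ _⟩
    refine ⟨w (t.image fun x => (x, n x)), ⟨mem_range_self _, fun x hx => ?_⟩, ?_⟩
    · obtain ⟨z, hz, hzx⟩ := mem_iUnion₂.1 (ht hx)
      exact mem_iUnion₂.2 ⟨(z, n z), Finset.mem_image_of_mem _ hz, hzx⟩
    · intro hyw
      obtain ⟨p, hp, hyp⟩ := mem_iUnion₂.1 hyw
      obtain ⟨z, -, rfl⟩ := Finset.mem_image.1 hp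
      exact hn z hyp

/-- In a space where every open cover has a subcover of size at most the continuum, a family of
closed sets whose intersection lies in a set `K` with small pseudocharacter has a small subfamily
with the same property. -/
theorem exists_small_subfamily_of_isClosed {X A : Type*} [TopologicalSpace X]
    (hL : ∀ 𝒰 ∈ openCovers X, ∃ 𝒱 ⊆ 𝒰, Cardinal.mk 𝒱 ≤ 𝔠 ∧ ⋃₀ 𝒱 = univ) {K : Set X}
    {𝒲 : Set (Set X)} (h𝒲 : Cardinal.mk 𝒲 ≤ 𝔠) (hKW : ∀ W ∈ 𝒲, IsOpen W ∧ K ⊆ W)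
    (hW : ∀ y ∉ K, ∃ W ∈ 𝒲, y ∉ W) {D : A → Set X} (hD : ∀ a, IsClosed (D a))
    (hDK : ⋂ a, D a ⊆ K) :
    ∃ 𝒟 ⊆ range D, Cardinal.mk 𝒟 ≤ 𝔠 ∧ ⋂₀ 𝒟 ⊆ K := by
  -- Each `W` together with the complements of the `D a` covers `X`; the complements kept in a small
  -- subcover cut the intersection down to inside `W`.
  have hsub : ∀ W : 𝒲, ∃ 𝒱 ⊆ insert (W : Set X) (range fun a => (D a)ᶜ),
      Cardinal.mk 𝒱 ≤ 𝔠 ∧ ⋃₀ 𝒱 = univ := fun W => by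
    refine hL _ ⟨?_, eq_univ_of_forall fun y => ?_⟩
    · rintro V (rfl | ⟨a, rfl⟩)
      · exact (hKW _ W.2).1
      · exact (hD a).isOpen_compl
    · by_cases hy : y ∈ K
      · exact ⟨W, mem_insert _ _, (hKW _ W.2).2 hy⟩
      · obtain ⟨a, ha⟩ := not_forall.1 (mt mem_iInter.2 fun h => hy (hDK h))
        exact ⟨(D a)ᶜ, mem_insert_of_mem _ ⟨a, rfl⟩, ha⟩
  choose 𝒱 h𝒱 h𝒱c h𝒱u using hsub
  refine ⟨range D ∩ ⋃ W, compl '' 𝒱 W, inter_subset_left, ?_, ?_⟩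
  · refine (Cardinal.mk_le_mk_of_subset inter_subset_right).trans ?_
    exact mk_iUnion_le_continuum h𝒲 fun W => Cardinal.mk_image_le.trans (h𝒱c W)
  · intro y hy
    by_contra hyK
    obtain ⟨W, hWm, hyW⟩ := hW y hyK
    obtain ⟨V, hV, hyV⟩ : y ∈ ⋃₀ 𝒱 ⟨W, hWm⟩ := by
      rw [h𝒱u]
      trivial
    rcases h𝒱 _ hV with rfl | ⟨a, rfl⟩
    · exact hyW hyV
    · exact hyV (hy _ ⟨⟨a, rfl⟩, mem_iUnion.2 ⟨⟨W, hWm⟩, _, hV, compl_compl _⟩⟩)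

/-! ### Answers to open covers -/

theorem singleton_univ_mem_openCovers (X : Type*) [TopologicalSpace X] :
    ({univ} : Set (Set X)) ∈ openCovers X := by
  simp [openCovers]

/-- If a finite subset `r 𝒞` is selected from every open cover `𝒞` of a regular space, then the
points that lie in `closure (⋃₀ r 𝒞)` for all `𝒞` form a compact set. -/
theorem isCompact_iInter_closure_sUnion {X : Type*} [TopologicalSpace X] [RegularSpace X]
    {r : openCovers X → Set (Set X)} (hfin : ∀ 𝒞, (r 𝒞).Finite) (hsub : ∀ 𝒞, r 𝒞 ⊆ 𝒞.1) :
    IsCompact (⋂ 𝒞, closure (⋃₀ r 𝒞)) := by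
  classical
  set K := ⋂ 𝒞, closure (⋃₀ r 𝒞) with hKdef
  have hKc : IsClosed K := isClosed_iInter fun _ => isClosed_closure
  refine isCompact_of_finite_subcover fun {ι} U hUo hKU => ?_
  have hnhds : ∀ x : X, ∀ O : Set X, IsOpen O → x ∈ O → ∃ V, IsOpen V ∧ x ∈ V ∧ closure V ⊆ O :=
    fun x O hO hx => by
      obtain ⟨V, hV, hVc, hVO⟩ := exists_mem_nhds_isClosed_subset (hO.mem_nhds hx)
      exact ⟨interior V, isOpen_interior, mem_interior_iff_mem_nhds.2 hV,
        (closure_minimal interior_subset hVc).trans hVO⟩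
  -- The closure of the finite union `⋃₀ r 𝒞` is a finite union of closures, contains `K`, and each
  -- of its pieces misses `K` or fits in a single `U i`.
  let 𝒞 : Set (Set X) := {V | IsOpen V ∧ (closure V ⊆ Kᶜ ∨ ∃ i, closure V ⊆ U i)}
  have h𝒞 : 𝒞 ∈ openCovers X := by
    refine ⟨fun V hV => hV.1, eq_univ_of_forall fun x => ?_⟩
    by_cases hx : x ∈ K
    · obtain ⟨i, hi⟩ := mem_iUnion.1 (hKU hx)
      obtain ⟨V, hVo, hxV, hV⟩ := hnhds x _ (hUo i) hi
      exact ⟨V, ⟨hVo, Or.inr ⟨i, hV⟩⟩, hxV⟩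
    · obtain ⟨V, hVo, hxV, hV⟩ := hnhds x _ hKc.isOpen_compl hx
      exact ⟨V, ⟨hVo, Or.inl hV⟩, hxV⟩
  have hi : ∀ V : Set X, ∃ T : Finset ι, V ∈ 𝒞 → K ∩ closure V ⊆ ⋃ i ∈ T, U i := fun V => by
    by_cases hV : V ∈ 𝒞
    · rcases hV.2 with h | ⟨i, h⟩
      · exact ⟨∅, fun _ x hx => absurd hx.1 (h hx.2)⟩
      · exact ⟨{i}, fun _ x hx => by simpa using h hx.2⟩
    · exact ⟨∅, fun h => absurd h hV⟩
  choose T hT using hi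
  refine ⟨(hfin ⟨𝒞, h𝒞⟩).toFinset.biUnion T, fun x hx => ?_⟩
  have hxcl : x ∈ closure (⋃₀ r ⟨𝒞, h𝒞⟩) := mem_iInter.1 hx _
  rw [sUnion_eq_biUnion, (hfin _).closure_biUnion] at hxcl
  obtain ⟨V, hV, hxV⟩ := mem_iUnion₂.1 hxcl
  obtain ⟨i, hiT, hxi⟩ := mem_iUnion₂.1 (hT V (hsub _ hV) ⟨hx, hxV⟩)
  exact mem_iUnion₂.2 ⟨i, Finset.mem_biUnion.2 ⟨V, by simpa using hV, hiT⟩, hxi⟩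

/-- Continuum many open covers suffice to cut out the compact set of
`isCompact_iInter_closure_sUnion`. -/
theorem exists_continuum_covers {X : Type*} [TopologicalSpace X] [T3Space X]
    (hGδ : ∀ x : X, IsGδ ({x} : Set X))
    (hL : ∀ 𝒰 ∈ openCovers X, ∃ 𝒱 ⊆ 𝒰, Cardinal.mk 𝒱 ≤ 𝔠 ∧ ⋃₀ 𝒱 = univ)
    {r : openCovers X → Set (Set X)} (hfin : ∀ 𝒞, (r 𝒞).Finite) (hsub : ∀ 𝒞, r 𝒞 ⊆ 𝒞.1) :
    ∃ e : Set ℕ → openCovers X,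
      ∀ y ∉ ⋂ 𝒞, closure (⋃₀ r 𝒞), ∃ j, y ∉ closure (⋃₀ r (e j)) := by
  obtain ⟨𝒲, h𝒲, hKW, hW⟩ :=
    (isCompact_iInter_closure_sUnion hfin hsub).exists_iInter_isOpen_eq hGδ
  obtain ⟨𝒟, h𝒟, h𝒟c, h𝒟K⟩ := exists_small_subfamily_of_isClosed hL h𝒲 hKW hW
    (D := fun 𝒞 => closure (⋃₀ r 𝒞)) (fun _ => isClosed_closure) subset_rfl
  let 𝒞₀ : openCovers X := ⟨{univ}, singleton_univ_mem_openCovers X⟩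
  have hpre : ∀ E, ∃ 𝒞, E ∈ 𝒟 → closure (⋃₀ r 𝒞) = E := fun E => by
    by_cases hE : E ∈ 𝒟
    · obtain ⟨𝒞, h𝒞⟩ := h𝒟 hE
      exact ⟨𝒞, fun _ => h𝒞⟩
    · exact ⟨𝒞₀, fun h => absurd h hE⟩
  choose g hg using hpre
  -- `𝒞₀` keeps the family nonempty, so that `Set ℕ` can enumerate it.
  have hc : Cardinal.mk (insert 𝒞₀ (g '' 𝒟) : Set (openCovers X)) ≤ 𝔠 :=
    Cardinal.mk_insert_le.trans (Cardinal.add_le_of_le Cardinal.aleph0_le_continuum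
      (Cardinal.mk_image_le.trans h𝒟c) (by simpa using (Cardinal.nat_lt_continuum 1).le))
  obtain ⟨e, he⟩ := exists_range_eq_of_mk_le_continuum (insert_nonempty _ _) hc
  refine ⟨e, fun y hy => ?_⟩
  obtain ⟨E, hE, hyE⟩ : ∃ E ∈ 𝒟, y ∉ E := by
    by_contra! h
    exact hy (h𝒟K fun E hE => h E hE)
  obtain ⟨j, hj⟩ : g E ∈ range e := he ▸ mem_insert_of_mem _ (mem_image_of_mem g hE)
  refine ⟨j, ?_⟩
  rw [hj]
  rwa [hg E hE]

/-! ### Trees of plays -/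

/-- The play in which inning `α` is the move `e α p (f α)`, where `p` is the play before `α`. -/
noncomputable def codedPlay {I J A : Type*} [LinearOrder I] [WellFoundedLT I]
    (e : (α : I) → (Iio α → A) → J → A) (f : I → J) : I → A :=
  wellFounded_lt.fix fun α p => e α (fun β => p β β.2) (f α)

theorem codedPlay_apply {I J A : Type*} [LinearOrder I] [WellFoundedLT I]
    (e : (α : I) → (Iio α → A) → J → A) (f : I → J) (α : I) :
    codedPlay e f α = e α (fun β => codedPlay e f β) (f α) := by
  rw [codedPlay, WellFounded.fix_eq]

theorem codedPlay_congr {I J A : Type*} [LinearOrder I] [WellFoundedLT I]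
    (e : (α : I) → (Iio α → A) → J → A) {f g : I → J} {α : I} (h : ∀ β < α, f β = g β) :
    ∀ β < α, codedPlay e f β = codedPlay e g β := by
  intro β
  induction β using WellFoundedLT.induction with
  | ind β ih =>
    intro hβ
    rw [codedPlay_apply, codedPlay_apply e g, h β hβ]
    congr 1
    funext γ
    exact ih γ γ.2 (γ.2.trans hβ)

/-- Any way of choosing codes depending on the earlier moves is realised by a coded play. -/
theorem exists_codedPlay_eq {I J A : Type*} [LinearOrder I] [WellFoundedLT I]
    (e : (α : I) → (Iio α → A) → J → A) (c : (α : I) → (Iio α → A) → J) :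
    ∃ f : I → J, ∀ α, f α = c α (fun β => codedPlay e f β) := by
  -- The play obtained by always following `c`; the codes are then read off from it.
  let ψ : I → A := codedPlay (fun α p (_ : Unit) => e α p (c α p)) fun _ => ()
  have hψ : ∀ α, ψ α = e α (fun β => ψ β) (c α fun β => ψ β) := fun α => codedPlay_apply _ _ α
  let f : I → J := fun α => c α fun β => ψ β
  have hf : ∀ α, codedPlay e f α = ψ α := fun α => by
    induction α using WellFoundedLT.induction with
    | ind α ih =>
      rw [codedPlay_apply, hψ]
      congr 1
      funext β
      exact ih β β.2
  exact ⟨f, fun α => by simp only [hf, f]⟩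

/-- If `J` has size at most the continuum, `I` is well-ordered of size at most the continuum with
countable initial segments, then the coded plays have at most continuum many positions. -/
theorem mk_le_continuum_of_codedPlay {X I J A : Type*} [LinearOrder I] [WellFoundedLT I]
    [Nonempty J] (hI : Cardinal.mk I ≤ 𝔠) (hI' : ∀ α : I, Countable (Iio α))
    (hJ : Cardinal.mk J ≤ 𝔠) (e : (α : I) → (Iio α → A) → J → A)
    (K : (α : I) → (Iio α → A) → Set X) (hK : ∀ α p, Cardinal.mk (K α p) ≤ 𝔠)
    (hX : ∀ y, ∃ (f : I → J) (α : I), y ∈ K α fun β => codedPlay e f β) :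
    Cardinal.mk X ≤ 𝔠 := by
  classical
  obtain ⟨j₀⟩ := ‹Nonempty J›
  -- The filler `j₀` is harmless: a position before `α` depends only on codes before `α`.
  let ext : (α : I) → (Iio α → J) → I → J := fun α s β => if h : β < α then s ⟨β, h⟩ else j₀
  let B : I → Set X := fun α => ⋃ s : Iio α → J, K α fun β => codedPlay e (ext α s) β
  have hB : ∀ α, Cardinal.mk (B α) ≤ 𝔠 := fun α => by
    refine mk_iUnion_le_continuum ?_ fun s => hK _ _
    rw [Cardinal.mk_arrow]
    have h1 := Cardinal.lift_le_continuum.2 hJ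
    have h2 : Cardinal.lift (Cardinal.mk (Iio α)) ≤ ℵ₀ := Cardinal.lift_le_aleph0.2
      (Cardinal.mk_le_aleph0_iff.2 (hI' α))
    exact (Cardinal.power_le_power_right h1).trans
      ((Cardinal.power_le_power_left Cardinal.continuum_ne_zero h2).trans
        Cardinal.continuum_power_aleph0.le)
  have hu : ⋃ α, B α = univ := eq_univ_of_forall fun y => by
    obtain ⟨f, α, hy⟩ := hX y
    refine mem_iUnion.2 ⟨α, mem_iUnion.2 ⟨fun β => f β, ?_⟩⟩
    have : (fun β : Iio α => codedPlay e (ext α fun β => f β) β) =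
        fun β : Iio α => codedPlay e f β := by
      funext β
      exact codedPlay_congr e (fun γ hγ => by simp [ext, hγ]) β β.2
    rwa [this]
  rw [← Cardinal.mk_univ, ← hu]
  exact mk_iUnion_le_continuum hI hB

/-! ### The long Menger game -/

theorem mk_Iio_omega_one_le_continuum : Cardinal.mk (Iio (ω₁ : Ordinal.{0})) ≤ 𝔠 := by
  rw [Cardinal.mk_Iio_ordinal, Cardinal.lift_le_continuum, Ordinal.card_omega]
  exact Cardinal.aleph_one_le_continuum

theorem countable_Iio_of_Iio_omega_one (α : Iio (ω₁ : Ordinal.{0})) : Countable (Iio α) := by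
  have h : (α : Ordinal).card ≤ ℵ₀ := by
    have := Cardinal.lt_omega_iff_card_lt.1 α.2
    rwa [← Cardinal.succ_aleph0, Order.lt_succ_iff] at this
  have : Countable (Iio (α : Ordinal)) := by
    rw [← Cardinal.mk_le_aleph0_iff, Cardinal.mk_Iio_ordinal]
    exact Cardinal.lift_le_aleph0.2 h
  exact Function.Injective.countable (f := fun β : Iio α => (⟨β.1.1, β.2⟩ : Iio (α : Ordinal)))
    fun β γ h => Subtype.ext (Subtype.ext (Subtype.mk.inj h))

/-- Player I's constant plays show that open covers have small subcovers. -/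
theorem PlayerIIWinsGfin.exists_small_subcover {X : Type*} [TopologicalSpace X]
    (hII : PlayerIIWinsGfin (ω₁ : Ordinal.{0}) (openCovers X) (openCovers X))
    (𝒰 : Set (Set X)) (h𝒰 : 𝒰 ∈ openCovers X) :
    ∃ 𝒱 ⊆ 𝒰, Cardinal.mk 𝒱 ≤ 𝔠 ∧ ⋃₀ 𝒱 = univ := by
  obtain ⟨F, hF⟩ := hII
  refine ⟨_, ?_, ?_, (hF fun _ => ⟨𝒰, h𝒰⟩).2⟩
  · exact iUnion_subset fun α => F.move_subset α _
  · refine mk_iUnion_le_continuum mk_Iio_omega_one_le_continuum fun α => ?_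
    exact (F.move_finite α _).countable.le_aleph0.trans Cardinal.aleph0_le_continuum

/-- The sequence of moves `p` before inning `α`, followed by the move `C` in inning `α`. -/
noncomputable def snocMove {I A : Type*} [LinearOrder I] {α : I} (p : Iio α → A) (C : A) :
    Iic α → A :=
  fun β => if h : β.1 < α then p ⟨β, h⟩ else C

theorem snocMove_last {I A : Type*} [LinearOrder I] {α : I} (p : Iio α → A) (C : A) :
    snocMove p C ⟨α, mem_Iic.2 le_rfl⟩ = C := by
  simp [snocMove]

theorem snocMove_restrict {I A : Type*} [LinearOrder I] (φ : I → A) (α : I) :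
    snocMove (fun β : Iio α => φ β) (φ α) = fun β : Iic α => φ β := by
  funext β
  rcases lt_or_eq_of_le β.2 with h | h
  · simp [snocMove, show β.1 < α from h]
  · simp [snocMove, h]

theorem PlayerIIWinsGfin.mk_le_continuum {X : Type*} [TopologicalSpace X] [T3Space X]
    (hGδ : ∀ x : X, IsGδ ({x} : Set X))
    (hII : PlayerIIWinsGfin (ω₁ : Ordinal.{0}) (openCovers X) (openCovers X)) :
    Cardinal.mk X ≤ 𝔠 := by
  have hL := hII.exists_small_subcover
  obtain ⟨F, hF⟩ := hII
  let r : (α : Iio (ω₁ : Ordinal.{0})) → (Iio α → openCovers X) → openCovers X → Set (Set X) :=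
    fun α p C => F.move α (snocMove p C)
  have hfin : ∀ α p C, (r α p C).Finite := fun α p C => F.move_finite α _
  have hsub : ∀ α p C, r α p C ⊆ C.1 := fun α p C =>
    (F.move_subset α _).trans (by rw [snocMove_last])
  let K : (α : Iio (ω₁ : Ordinal.{0})) → (Iio α → openCovers X) → Set X :=
    fun α p => ⋂ C, closure (⋃₀ r α p C)
  choose e he using fun α p => exists_continuum_covers hGδ hL (hfin α p) (hsub α p)
  refine mk_le_continuum_of_codedPlay (J := Set ℕ) mk_Iio_omega_one_le_continuum
    countable_Iio_of_Iio_omega_one Cardinal.mk_set_nat.le e K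
    (fun α p => (isCompact_iInter_closure_sUnion (hfin α p) (hsub α p)).mk_le_continuum hGδ)
    fun y => ?_
  -- For fixed `y`, the codes `c` form a counterstrategy of I that avoids `y` at every position with
  -- `y ∉ K α p`.
  have hj : ∀ α p, ∃ j, y ∉ K α p → y ∉ closure (⋃₀ r α p (e α p j)) := fun α p => by
    by_cases hy : y ∈ K α p
    · exact ⟨∅, fun h => absurd hy h⟩
    · obtain ⟨j, hj⟩ := he α p y hy
      exact ⟨j, fun _ => hj⟩
  choose c hc using hj
  obtain ⟨f, hf⟩ := exists_codedPlay_eq e c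
  refine ⟨f, ?_⟩
  by_contra! hy
  obtain ⟨V, hV, hyV⟩ : y ∈ ⋃₀ ⋃ α, F.move α fun β => codedPlay e f β := by
    rw [(hF (codedPlay e f)).2]
    trivial
  obtain ⟨α, hα⟩ := mem_iUnion.1 hV
  refine hc α _ (hy α) (subset_closure ⟨V, ?_, hyV⟩)
  rw [← hf, ← codedPlay_apply e f α]
  simpa only [r, snocMove_restrict] using hα

theorem corollary2p12 (CH : (ℵ₁ : Cardinal.{0}) = 2 ^ (ℵ₀ : Cardinal.{0}))
    {X : Type*} [TopologicalSpace X] [T35Space X]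
    (hGδ : ∀ x : X, IsGδ ({x} : Set X))
    (hII : PlayerIIWinsGfin (ω₁ : Ordinal.{0}) (openCovers X) (openCovers X)) :
    Cardinal.mk X ≤ 2 ^ ℵ₀ := by
  rw [Cardinal.two_power_aleph0]
  exact hII.mk_le_continuum hGδ
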